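/- For $n\in\mathbb N$ let $M_n(\mathbb C)$ be the complex $n\times n$ matrices and $M_n^+(\mathbb C)$ the positive semidefinite ones. For $X,Y\in M_n^+(\mathbb C)$, the Umegaki relative entropy $D(X\|Y)\in(-\infty,+\infty]$ is $$D(X\|Y)=\operatorname{tr}[X(\log X-\log Y)]\ \text{ if }\ker Y\subseteq\ker X,\qquad D(X\|Y)=+\infty\ \text{ otherwise},$$ where $X\log X$ is defined with $0\log 0=0$, and $\log Y$ is taken to be $0$ on $\ker Y$ (a choice which does not affect the trace when $\ker Y\subseteq \ker X$). A linear map $\Phi:M_n(\mathbb C)\to M_m(\mathbb C)$ is completely positive if for every $k$ and every positive semidefinite block matrix $[A_{ij}]_{i,j=1}^k$ with $A_{ij}\in M_n(\mathbb C)$ the block matrix $[\Phi(A_{ij})]_{i,j=1}^k$ is positive semidefinite; it is unital if $\Phi(I)=I$; and $\Phi^\dagger:M_m(\mathbb C)\to M_n(\mathbb C)$ denotes its adjoint with respect to the Hilbert–Schmidt inner products $\langle A,B\rangle=\operatorname{tr}[A^*B]$. **Theorem (Data Processing Inequality).** For all $m,n\in\mathbb N$, all $X,Y\in M_m^+(\mathbb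 C)$, and all completely positive unital maps $\Phi:M_n(\mathbb C)\to M_m(\mathbb C)$, $$D(\Phi^\dagger(X)\,\|\,\Phi^\dagger(Y))\le D(X\|Y).$$ -/

import Mathlib

open scoped ComplexOrder Matrix

namespace QuantumDPI

/-- A linear map `Φ : M_n(ℂ) → M_m(ℂ)` is `k`-positive if, for every `k × k` block matrix
`[A i j]` with entries in `M_n(ℂ)` that is positive semidefinite (as a `kn × kn` complex matrix),
the block matrix `[Φ (A i j)]` is positive semidefinite. -/
def IsKPositive {n m : Type*} [Fintype n] [Fintype m] (k : ℕ)
    (Φ : Matrix n n ℂ →ₗ[ℂ] Matrix m m ℂ) : Prop :=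
  ∀ A : Matrix (Fin k) (Fin k) (Matrix n n ℂ),
    (Matrix.comp (Fin k) (Fin k) n n ℂ A).PosSemidef →
      (Matrix.comp (Fin k) (Fin k) m m ℂ (A.map Φ)).PosSemidef

/-- A linear map is completely positive if it is `k`-positive for all `k`. -/
def IsCompletelyPositive {n m : Type*} [Fintype n] [Fintype m]
    (Φ : Matrix n n ℂ →ₗ[ℂ] Matrix m m ℂ) : Prop :=
  ∀ k : ℕ, IsKPositive k Φ

/-- The map is unital if it takes the identity matrix to the identity matrix. -/
def IsUnital {n m : Type*} [DecidableEq n] [DecidableEq m]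
    (Φ : Matrix n n ℂ →ₗ[ℂ] Matrix m m ℂ) : Prop :=
  Φ 1 = 1

/-- The adjoint `Φ†` of `Φ` with respect to the Hilbert–Schmidt inner product
`⟨A, B⟩ = tr (Aᴴ B)`. Its `(i, j)` entry at `X` is `⟨E i j, Φ† X⟩ = ⟨Φ (E i j), X⟩`, where `E i j`
is the matrix unit; the defining property of the adjoint is `trace_mul_hsAdjoint` below. -/
noncomputable def hsAdjoint {n m : Type*} [Fintype m] [DecidableEq n]
    (Φ : Matrix n n ℂ →ₗ[ℂ] Matrix m m ℂ) : Matrix m m ℂ →ₗ[ℂ] Matrix n n ℂ where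
  toFun X := Matrix.of fun i j => ((Φ (Matrix.single i j 1))ᴴ * X).trace
  map_add' X Y := by
    ext i j
    simp [Matrix.mul_add]
  map_smul' c X := by
    ext i j
    simp

/-- The defining property of the Hilbert–Schmidt adjoint: `⟨A, Φ† X⟩ = ⟨Φ A, X⟩`. -/
theorem trace_mul_hsAdjoint {n m : Type*} [Fintype n] [Fintype m] [DecidableEq n]
    (Φ : Matrix n n ℂ →ₗ[ℂ] Matrix m m ℂ) (A : Matrix n n ℂ) (X : Matrix m m ℂ) :
    (Aᴴ * hsAdjoint Φ X).trace = ((Φ A)ᴴ * X).trace := by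
  have hA : Φ A = ∑ i, ∑ j, A i j • Φ (Matrix.single i j 1) := by
    conv_lhs => rw [Matrix.matrix_eq_sum_single A]
    simp only [map_sum, ← map_smul]
    simp
  rw [hA]
  simp only [Matrix.conjTranspose_sum, Matrix.conjTranspose_smul, Matrix.sum_mul,
    Matrix.trace_sum, Matrix.smul_mul, Matrix.trace_smul]
  rw [Finset.sum_comm]
  simp [Matrix.trace, Matrix.mul_apply, hsAdjoint]

open Classical in
/-- The Umegaki relative entropy `D(X‖Y) = tr [X (log X - log Y)]` of positive semidefinite
matrices, with values in `(-∞, +∞]`. It equals `+∞` unless `ker Y ⊆ ker X`. If `ker Y ⊆ ker X`,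
then neither `X log X` (where `0 log 0 = 0`) nor `X log Y` depends on the value that the
logarithms are given on the kernels of `X` and `Y`; the continuous functional calculus of
`Real.log` gives the value `0` there. The trace is a real number, so taking the real part loses
nothing. -/
noncomputable def relEntropy {n : Type*} [Fintype n] [DecidableEq n]
    (X Y : Matrix n n ℂ) : EReal :=
  if ∀ v : n → ℂ, Y *ᵥ v = 0 → X *ᵥ v = 0 then
    (((X * (cfc Real.log X - cfc Real.log Y)).trace.re : ℝ) : EReal)
  else ⊤

end QuantumDPI

/-! For `t > 0` the resolvent form `⟨X, (L_Y + t R_X)⁻¹ X⟩` is the maximum over `Z` of the concave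
quadratic `varForm t X Y Z`. The Kadison–Schwarz inequality, applied to `W` and to `Wᴴ`, shows that
`varForm` at `(Φ† X, Φ† Y, W)` is at most its value at `(X, Y, Φ W)`. Hence the resolvent form
decreases under `Φ†` (`IsKPositive.resolventForm_hsAdjoint_le`). If `ker Y ⊆ ker X`, integrating it
over `[0, T]`, subtracting `tr X · log T` and letting `T → ∞` gives `D(X‖Y)`
(`tendsto_integral_resolventForm`). Since `Φ†` preserves traces and the kernel inclusion, the
inequality passes to the limit. Only 2-positivity enters. -/

namespace QuantumDPI

open Matrix Filter Topology

/-! ### Resolvent form, its variational formula, and the integral formula for relative entropy. -/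

section Spectral

variable {n : Type*} [Fintype n] [DecidableEq n]

/-- Trace of a product of two diagonalised matrices, in terms of the overlaps of the bases. -/
theorem trace_diagonalized_mul_diagonalized (U V : Matrix n n ℂ) (a b : n → ℝ) :
    ((U * diagonal (fun i => (a i : ℂ)) * Uᴴ) * (V * diagonal (fun i => (b i : ℂ)) * Vᴴ)).trace =
      ((∑ i, ∑ j, Complex.normSq ((Vᴴ * U) j i) * (a i * b j) : ℝ) : ℂ) := by
  have h : ((U * diagonal (fun i => (a i : ℂ)) * Uᴴ) *
      (V * diagonal (fun i => (b i : ℂ)) * Vᴴ)).trace =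
      (diagonal (fun i => (a i : ℂ)) * (((Vᴴ * U)ᴴ * diagonal (fun i => (b i : ℂ))) *
        (Vᴴ * U))).trace := by
    rw [show (U * diagonal (fun i => (a i : ℂ)) * Uᴴ) * (V * diagonal (fun i => (b i : ℂ)) * Vᴴ) =
      U * (diagonal (fun i => (a i : ℂ)) * (Uᴴ * (V * diagonal (fun i => (b i : ℂ)) * Vᴴ))) by
        simp only [Matrix.mul_assoc], trace_mul_comm]
    simp only [Matrix.mul_assoc, conjTranspose_mul, conjTranspose_conjTranspose]
  rw [h, trace]
  push_cast
  refine Finset.sum_congr rfl fun i _ => ?_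
  rw [diag_apply, diagonal_mul, Matrix.mul_apply, Finset.mul_sum]
  refine Finset.sum_congr rfl fun j _ => ?_
  rw [mul_diagonal, conjTranspose_apply, Complex.normSq_eq_conj_mul_self, RCLike.star_def]
  ring

/-- The variational form whose supremum over `Z` is `⟨X, (L_Y + t R_X)⁻¹ X⟩`. -/
noncomputable def varForm (t : ℝ) (X Y Z : Matrix n n ℂ) : ℝ :=
  2 * (Zᴴ * X).trace.re - (Y * (Z * Zᴴ)).trace.re - t * (Zᴴ * Z * X).trace.re

/-- In the eigenbases of the two matrices the quadratic form decouples into one scalar problem for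
each entry of `M`. -/
theorem varForm_diagonalized (t : ℝ) {U V : Matrix n n ℂ} (hU : Uᴴ * U = 1) (hV : Vᴴ * V = 1)
    (x y : n → ℝ) (M : Matrix n n ℂ) :
    varForm t (U * diagonal (fun i => (x i : ℂ)) * Uᴴ) (V * diagonal (fun i => (y i : ℂ)) * Vᴴ)
      (V * M * Uᴴ) = ∑ i, ∑ j, (2 * (star (M j i) * (Vᴴ * U) j i).re * x i -
        (y j + t * x i) * Complex.normSq (M j i)) := by
  have h1 : ((V * M * Uᴴ)ᴴ * (U * diagonal (fun i => (x i : ℂ)) * Uᴴ)).trace =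
      (Mᴴ * (Vᴴ * U) * diagonal (fun i => (x i : ℂ))).trace := by
    rw [show (V * M * Uᴴ)ᴴ * (U * diagonal (fun i => (x i : ℂ)) * Uᴴ) =
      U * (Mᴴ * (Vᴴ * U) * diagonal (fun i => (x i : ℂ)) * Uᴴ) by
        simp only [Matrix.mul_assoc, conjTranspose_mul, conjTranspose_conjTranspose],
      trace_mul_comm, Matrix.mul_assoc, hU, Matrix.mul_one]
  have h2 : (V * diagonal (fun i => (y i : ℂ)) * Vᴴ * (V * M * Uᴴ * (V * M * Uᴴ)ᴴ)).trace =
      (diagonal (fun i => (y i : ℂ)) * (M * Mᴴ)).trace := by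
    rw [show V * diagonal (fun i => (y i : ℂ)) * Vᴴ * (V * M * Uᴴ * (V * M * Uᴴ)ᴴ) =
      V * (diagonal (fun i => (y i : ℂ)) * (Vᴴ * V) * (M * (Uᴴ * U) * Mᴴ) * Vᴴ) by
        simp only [Matrix.mul_assoc, conjTranspose_mul, conjTranspose_conjTranspose],
      trace_mul_comm, hU, hV]
    simp only [← Matrix.mul_assoc, Matrix.mul_one]
    rw [Matrix.mul_assoc _ Vᴴ V, hV, Matrix.mul_one]
  have h3 : ((V * M * Uᴴ)ᴴ * (V * M * Uᴴ) * (U * diagonal (fun i => (x i : ℂ)) * Uᴴ)).trace =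
      (Mᴴ * M * diagonal (fun i => (x i : ℂ))).trace := by
    rw [show (V * M * Uᴴ)ᴴ * (V * M * Uᴴ) * (U * diagonal (fun i => (x i : ℂ)) * Uᴴ) =
      U * (Mᴴ * (Vᴴ * V) * M * (Uᴴ * U) * diagonal (fun i => (x i : ℂ)) * Uᴴ) by
        simp only [Matrix.mul_assoc, conjTranspose_mul, conjTranspose_conjTranspose],
      trace_mul_comm, Matrix.mul_assoc, hU, hV, Matrix.mul_one, Matrix.mul_one, Matrix.mul_one]
  have h4 : (diagonal (fun i => (y i : ℂ)) * (M * Mᴴ)).trace.re =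
      ∑ i, ∑ j, y j * Complex.normSq (M j i) := by
    rw [Finset.sum_comm, trace, Complex.re_sum]
    refine Finset.sum_congr rfl fun j _ => ?_
    rw [diag_apply, diagonal_mul, Matrix.mul_apply, Finset.mul_sum, Complex.re_sum]
    refine Finset.sum_congr rfl fun i _ => ?_
    rw [conjTranspose_apply, RCLike.star_def, Complex.mul_conj, ← Complex.ofReal_mul,
      Complex.ofReal_re]
  have h5 : (Mᴴ * M * diagonal (fun i => (x i : ℂ))).trace.re =
      ∑ i, ∑ j, x i * Complex.normSq (M j i) := by
    rw [trace, Complex.re_sum]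
    refine Finset.sum_congr rfl fun i _ => ?_
    rw [diag_apply, mul_diagonal, Matrix.mul_apply, Finset.sum_mul, Complex.re_sum]
    refine Finset.sum_congr rfl fun j _ => ?_
    rw [conjTranspose_apply, RCLike.star_def, mul_comm (_ * _), ← Complex.normSq_eq_conj_mul_self,
      ← Complex.ofReal_mul, Complex.ofReal_re]
  have h6 : (Mᴴ * (Vᴴ * U) * diagonal (fun i => (x i : ℂ))).trace.re =
      ∑ i, ∑ j, (star (M j i) * (Vᴴ * U) j i).re * x i := by
    rw [trace, Complex.re_sum]
    refine Finset.sum_congr rfl fun i _ => ?_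
    rw [diag_apply, mul_diagonal, Matrix.mul_apply, Finset.sum_mul, Complex.re_sum]
    refine Finset.sum_congr rfl fun j _ => ?_
    rw [conjTranspose_apply, Complex.re_mul_ofReal]
  rw [varForm, h1, h2, h3, h4, h5, h6]
  simp only [Finset.mul_sum, ← Finset.sum_sub_distrib]
  refine Finset.sum_congr rfl fun i _ => Finset.sum_congr rfl fun j _ => ?_
  ring

/-- Squared moduli of the overlaps of the eigenbases of two Hermitian matrices. -/
noncomputable def overlap {X Y : Matrix n n ℂ} (hX : X.IsHermitian) (hY : Y.IsHermitian)
    (i j : n) : ℝ :=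
  Complex.normSq (((hY.eigenvectorUnitary : Matrix n n ℂ)ᴴ * hX.eigenvectorUnitary) j i)

theorem overlap_nonneg {X Y : Matrix n n ℂ} (hX : X.IsHermitian) (hY : Y.IsHermitian) (i j : n) :
    0 ≤ overlap hX hY i j :=
  Complex.normSq_nonneg _

theorem eigenvectorUnitary_conjTranspose_mul_self {X : Matrix n n ℂ} (hX : X.IsHermitian) :
    (hX.eigenvectorUnitary : Matrix n n ℂ)ᴴ * hX.eigenvectorUnitary = 1 :=
  Unitary.coe_star_mul_self _

theorem cfc_eq_diagonalized {X : Matrix n n ℂ} (hX : X.IsHermitian) (f : ℝ → ℝ) :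
    cfc f X = (hX.eigenvectorUnitary : Matrix n n ℂ) *
      diagonal (fun i => (f (hX.eigenvalues i) : ℂ)) * (hX.eigenvectorUnitary : Matrix n n ℂ)ᴴ := by
  rw [hX.cfc_eq]
  rfl

theorem eq_diagonalized {X : Matrix n n ℂ} (hX : X.IsHermitian) :
    X = (hX.eigenvectorUnitary : Matrix n n ℂ) *
      diagonal (fun i => (hX.eigenvalues i : ℂ)) * (hX.eigenvectorUnitary : Matrix n n ℂ)ᴴ :=
  hX.spectral_theorem

theorem trace_cfc_mul_cfc {X Y : Matrix n n ℂ} (hX : X.IsHermitian) (hY : Y.IsHermitian)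
    (f g : ℝ → ℝ) : (cfc f X * cfc g Y).trace =
      ((∑ i, ∑ j, overlap hX hY i j * (f (hX.eigenvalues i) * g (hY.eigenvalues j)) : ℝ) : ℂ) := by
  rw [cfc_eq_diagonalized hX, cfc_eq_diagonalized hY]
  exact trace_diagonalized_mul_diagonalized _ _ _ _

/-- The overlaps sum to one over `j`. This brings traces involving `X` alone into the double-sum
form of the mixed terms. -/
theorem trace_cfc {X Y : Matrix n n ℂ} (hX : X.IsHermitian) (hY : Y.IsHermitian)
    (f : ℝ → ℝ) : (cfc f X).trace =
      ((∑ i, ∑ j, overlap hX hY i j * f (hX.eigenvalues i) : ℝ) : ℂ) := by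
  have h := trace_cfc_mul_cfc hX hY f (fun _ => 1)
  rw [cfc_const_one ℝ Y, Matrix.mul_one] at h
  simpa using h

/-- The resolvent form `⟨X, (L_Y + t R_X)⁻¹ X⟩` in eigenbases of `X` and `Y`. -/
noncomputable def resolventForm {X Y : Matrix n n ℂ} (hX : X.IsHermitian) (hY : Y.IsHermitian)
    (t : ℝ) : ℝ :=
  ∑ i, ∑ j, overlap hX hY i j * (hX.eigenvalues i ^ 2 / (hY.eigenvalues j + t * hX.eigenvalues i))

/-- Completing the square: for `s > 0` the gap is `|x d - s m|² / s`. -/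
theorem two_mul_re_sub_le {x s : ℝ} (hs : 0 ≤ s) (hx : s = 0 → x = 0) (m d : ℂ) :
    2 * (star m * d).re * x - s * Complex.normSq m ≤ Complex.normSq d * (x ^ 2 / s) := by
  rcases hs.eq_or_lt with h | h
  · simp [hx h.symm, ← h]
  · rw [← sub_nonneg]
    have : Complex.normSq d * (x ^ 2 / s) - (2 * (star m * d).re * x - s * Complex.normSq m) =
        Complex.normSq (x * d - s * m) / s := by
      field_simp
      simp [Complex.normSq_apply]
      ring
    rw [this]
    exact div_nonneg (Complex.normSq_nonneg _) h.le

/-- The square vanishes at `m = (x / s) d`. If `s = 0` then `x = 0`, and the convention `x / 0 = 0`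
makes both sides zero. -/
theorem two_mul_re_sub_eq {x s : ℝ} (hx : s = 0 → x = 0) (d : ℂ) :
    2 * (star ((x / s : ℝ) * d) * d).re * x - s * Complex.normSq ((x / s : ℝ) * d) =
      Complex.normSq d * (x ^ 2 / s) := by
  by_cases h : s = 0
  · simp [hx h]
  · simp [Complex.normSq_apply]
    field_simp
    ring

theorem eq_zero_of_add_mul_eq_zero {x y t : ℝ} (hx : 0 ≤ x) (hy : 0 ≤ y) (ht : 0 < t)
    (h : y + t * x = 0) : x = 0 := by
  have := mul_nonneg ht.le hx
  have : t * x = 0 := by linarith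
  exact (mul_eq_zero.1 this).resolve_left ht.ne'

theorem varForm_le_resolventForm {X Y : Matrix n n ℂ} (hX : X.PosSemidef) (hY : Y.PosSemidef)
    {t : ℝ} (ht : 0 < t) (Z : Matrix n n ℂ) :
    varForm t X Y Z ≤ resolventForm hX.1 hY.1 t := by
  set U := (hX.1.eigenvectorUnitary : Matrix n n ℂ) with hU
  set V := (hY.1.eigenvectorUnitary : Matrix n n ℂ) with hV
  have hZ : Z = V * (Vᴴ * Z * U) * Uᴴ := by
    have h1 : V * Vᴴ = 1 := Unitary.coe_mul_star_self _
    have h2 : U * Uᴴ = 1 := Unitary.coe_mul_star_self _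
    rw [show V * (Vᴴ * Z * U) * Uᴴ = (V * Vᴴ) * Z * (U * Uᴴ) by simp only [Matrix.mul_assoc],
      h1, h2, Matrix.one_mul, Matrix.mul_one]
  have := varForm_diagonalized t (eigenvectorUnitary_conjTranspose_mul_self hX.1)
    (eigenvectorUnitary_conjTranspose_mul_self hY.1) hX.1.eigenvalues hY.1.eigenvalues (Vᴴ * Z * U)
  rw [← eq_diagonalized, ← eq_diagonalized, ← hU, ← hV, ← hZ] at this
  rw [this, resolventForm]
  refine Finset.sum_le_sum fun i _ => Finset.sum_le_sum fun j _ => ?_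
  have hx := hX.eigenvalues_nonneg i
  have hy := hY.eigenvalues_nonneg j
  exact two_mul_re_sub_le (by positivity) (eq_zero_of_add_mul_eq_zero hx hy ht) _ _

theorem exists_varForm_eq_resolventForm {X Y : Matrix n n ℂ} (hX : X.PosSemidef)
    (hY : Y.PosSemidef) {t : ℝ} (ht : 0 < t) :
    ∃ Z, varForm t X Y Z = resolventForm hX.1 hY.1 t := by
  let D : Matrix n n ℂ :=
    (hY.1.eigenvectorUnitary : Matrix n n ℂ)ᴴ * (hX.1.eigenvectorUnitary : Matrix n n ℂ)
  let M : Matrix n n ℂ := of fun j i =>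
    ((hX.1.eigenvalues i / (hY.1.eigenvalues j + t * hX.1.eigenvalues i) : ℝ) : ℂ) * D j i
  have := varForm_diagonalized t (eigenvectorUnitary_conjTranspose_mul_self hX.1)
    (eigenvectorUnitary_conjTranspose_mul_self hY.1) hX.1.eigenvalues hY.1.eigenvalues M
  rw [← eq_diagonalized, ← eq_diagonalized] at this
  refine ⟨_, this.trans ?_⟩
  rw [resolventForm]
  refine Finset.sum_congr rfl fun i _ => Finset.sum_congr rfl fun j _ => ?_
  exact two_mul_re_sub_eq
    (eq_zero_of_add_mul_eq_zero (hX.eigenvalues_nonneg i) (hY.eigenvalues_nonneg j) ht) _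

/-- If `ker Y ⊆ ker X`, eigenvectors of `Y` for the eigenvalue `0` do not overlap with the
support of `X`. -/
theorem overlap_mul_eigenvalues_eq_zero {X Y : Matrix n n ℂ} (hX : X.IsHermitian)
    (hY : Y.IsHermitian) (hker : ∀ v : n → ℂ, Y *ᵥ v = 0 → X *ᵥ v = 0) (i j : n)
    (hj : hY.eigenvalues j = 0) : overlap hX hY i j * hX.eigenvalues i = 0 := by
  have hXV : X *ᵥ ⇑(hY.eigenvectorBasis j) = 0 := by
    apply hker
    rw [hY.mulVec_eigenvectorBasis, hj, zero_smul]
  set U := (hX.eigenvectorUnitary : Matrix n n ℂ)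
  set V := (hY.eigenvectorUnitary : Matrix n n ℂ)
  have h1 : (Uᴴ * X * V) i j = 0 := by
    have : (X * V).col j = 0 := by
      rw [← hXV]
      rfl
    rw [Matrix.mul_assoc, Matrix.mul_apply]
    exact Finset.sum_eq_zero fun k _ => by
      rw [show (X * V) k j = 0 from congrFun this k, mul_zero]
  have h2 : Uᴴ * X * V = diagonal (fun i => (hX.eigenvalues i : ℂ)) * (Uᴴ * V) := by
    conv_lhs => rw [eq_diagonalized hX]
    change Uᴴ * (U * _ * Uᴴ) * V = _
    rw [show Uᴴ * (U * diagonal (fun i => (hX.eigenvalues i : ℂ)) * Uᴴ) * V =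
      (Uᴴ * U) * (diagonal (fun i => (hX.eigenvalues i : ℂ)) * (Uᴴ * V)) by
        simp only [Matrix.mul_assoc], eigenvectorUnitary_conjTranspose_mul_self, Matrix.one_mul]
  rw [h2, diagonal_mul] at h1
  rcases mul_eq_zero.1 h1 with h | h
  · rw [Complex.ofReal_eq_zero.1 h, mul_zero]
  · have h3 : (Vᴴ * U) j i = 0 := by
      rw [show Vᴴ * U = (Uᴴ * V)ᴴ by simp, conjTranspose_apply, h, star_zero]
    have : overlap hX hY i j = Complex.normSq ((Vᴴ * U) j i) := rfl
    rw [this, h3, map_zero, zero_mul]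

theorem integral_sq_div_add_mul {x y T : ℝ} (hx : 0 ≤ x) (hy : 0 < y) (hT : 0 ≤ T) :
    (∫ t in (0 : ℝ)..T, x ^ 2 / (y + t * x)) = x * (Real.log (y + T * x) - Real.log y) := by
  have hpos : ∀ t ∈ Set.uIcc 0 T, y + t * x ≠ 0 := fun t ht => by
    rw [Set.uIcc_of_le hT] at ht
    have := mul_nonneg ht.1 hx
    linarith
  rw [intervalIntegral.integral_eq_sub_of_hasDerivAt (f := fun t => x * Real.log (y + t * x))]
  · simp; ring
  · intro t ht
    have h := ((((hasDerivAt_id t).mul_const x).const_add y).log (hpos t ht)).const_mul x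
    refine h.congr_deriv ?_
    rw [one_mul, id]
    ring
  · apply ContinuousOn.intervalIntegrable
    exact continuousOn_const.div (by fun_prop) hpos

theorem intervalIntegrable_sq_div_add_mul {x y T : ℝ} (hx : 0 ≤ x) (hy : 0 < y) (hT : 0 ≤ T) :
    IntervalIntegrable (fun t => x ^ 2 / (y + t * x)) MeasureTheory.volume 0 T := by
  apply ContinuousOn.intervalIntegrable
  refine continuousOn_const.div (by fun_prop) fun t ht => ?_
  rw [Set.uIcc_of_le hT] at ht
  have := mul_nonneg ht.1 hx
  linarith

theorem overlap_mul_sq_div_eq_zero {X Y : Matrix n n ℂ} (hX : X.IsHermitian)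
    (hY : Y.IsHermitian) (hker : ∀ v : n → ℂ, Y *ᵥ v = 0 → X *ᵥ v = 0) (i j : n)
    (hj : hY.eigenvalues j = 0) (s : ℝ) : overlap hX hY i j * (hX.eigenvalues i ^ 2 / s) = 0 := by
  rw [show overlap hX hY i j * (hX.eigenvalues i ^ 2 / s) =
    (overlap hX hY i j * hX.eigenvalues i) * (hX.eigenvalues i / s) by ring,
    overlap_mul_eigenvalues_eq_zero hX hY hker i j hj, zero_mul]

theorem intervalIntegrable_overlap_mul {X Y : Matrix n n ℂ} (hX : X.PosSemidef)
    (hY : Y.PosSemidef) (hker : ∀ v : n → ℂ, Y *ᵥ v = 0 → X *ᵥ v = 0) {T : ℝ} (hT : 0 ≤ T)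
    (i j : n) : IntervalIntegrable (fun t => overlap hX.1 hY.1 i j *
      (hX.1.eigenvalues i ^ 2 / (hY.1.eigenvalues j + t * hX.1.eigenvalues i)))
      MeasureTheory.volume 0 T := by
  rcases (hY.eigenvalues_nonneg j).eq_or_lt with h | h
  · simp [overlap_mul_sq_div_eq_zero hX.1 hY.1 hker i j h.symm]
  · exact (intervalIntegrable_sq_div_add_mul (hX.eigenvalues_nonneg i) h hT).const_mul _

theorem intervalIntegrable_resolventForm {X Y : Matrix n n ℂ} (hX : X.PosSemidef)
    (hY : Y.PosSemidef) (hker : ∀ v : n → ℂ, Y *ᵥ v = 0 → X *ᵥ v = 0) {T : ℝ} (hT : 0 ≤ T) :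
    IntervalIntegrable (resolventForm hX.1 hY.1) MeasureTheory.volume 0 T := by
  have := IntervalIntegrable.sum Finset.univ fun i _ => IntervalIntegrable.sum Finset.univ
    fun j _ => intervalIntegrable_overlap_mul hX hY hker hT i j
  refine this.congr fun t _ => ?_
  simp [resolventForm]

theorem integral_resolventForm {X Y : Matrix n n ℂ} (hX : X.PosSemidef)
    (hY : Y.PosSemidef) (hker : ∀ v : n → ℂ, Y *ᵥ v = 0 → X *ᵥ v = 0) {T : ℝ} (hT : 0 ≤ T) :
    (∫ t in (0 : ℝ)..T, resolventForm hX.1 hY.1 t) =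
      ∑ i, ∑ j, overlap hX.1 hY.1 i j * (hX.1.eigenvalues i *
        (Real.log (hY.1.eigenvalues j + T * hX.1.eigenvalues i) -
          Real.log (hY.1.eigenvalues j))) := by
  simp only [resolventForm]
  rw [intervalIntegral.integral_finsetSum]
  swap
  · intro i _
    have := IntervalIntegrable.sum Finset.univ
      fun j _ => intervalIntegrable_overlap_mul hX hY hker hT i j
    refine this.congr fun t _ => ?_
    simp
  refine Finset.sum_congr rfl fun i _ => ?_
  rw [intervalIntegral.integral_finsetSum
    fun j _ => intervalIntegrable_overlap_mul hX hY hker hT i j]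
  refine Finset.sum_congr rfl fun j _ => ?_
  rcases (hY.eigenvalues_nonneg j).eq_or_lt with h | h
  · simp only [overlap_mul_sq_div_eq_zero hX.1 hY.1 hker i j h.symm]
    rw [← mul_assoc, overlap_mul_eigenvalues_eq_zero hX.1 hY.1 hker i j h.symm]
    simp
  · rw [intervalIntegral.integral_const_mul,
      integral_sq_div_add_mul (hX.eigenvalues_nonneg i) h hT]

/-- For `x > 0`, `log (y + T x) - log T = log (y / T + x)`, so subtracting `x log T` removes exactly
the divergence. -/
theorem tendsto_mul_log_add_mul_sub {x y : ℝ} (hx : 0 ≤ x) (hy : 0 < y) :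
    Tendsto (fun T : ℝ => x * (Real.log (y + T * x) - Real.log y) - x * Real.log T) atTop
      (𝓝 (x * (Real.log x - Real.log y))) := by
  rcases hx.eq_or_lt with h | h
  · simp [← h]
  · have h0 : Tendsto (fun T : ℝ => y / T + x) atTop (𝓝 x) := by
      simpa using (tendsto_const_nhds.div_atTop tendsto_id).add_const x
    have h1 : Tendsto (fun T : ℝ => x * (Real.log (y / T + x) - Real.log y)) atTop
        (𝓝 (x * (Real.log x - Real.log y))) :=
      ((h0.log h.ne').sub_const _).const_mul x
    refine h1.congr' ?_
    filter_upwards [eventually_gt_atTop 0] with T hT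
    rw [show y / T + x = (y + T * x) / T by field_simp,
      Real.log_div (by positivity) hT.ne']
    ring

/-- The resolvent integral of the relative entropy. -/
theorem tendsto_integral_resolventForm {X Y : Matrix n n ℂ} (hX : X.PosSemidef)
    (hY : Y.PosSemidef) (hker : ∀ v : n → ℂ, Y *ᵥ v = 0 → X *ᵥ v = 0) :
    Tendsto (fun T : ℝ => (∫ t in (0 : ℝ)..T, resolventForm hX.1 hY.1 t) -
      X.trace.re * Real.log T) atTop
      (𝓝 (X * (cfc Real.log X - cfc Real.log Y)).trace.re) := by
  have hXid : cfc (id : ℝ → ℝ) X = X := cfc_id ℝ X hX.1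
  have htr : X.trace.re = ∑ i, ∑ j, overlap hX.1 hY.1 i j * hX.1.eigenvalues i := by
    have := trace_cfc hX.1 hY.1 id
    rw [hXid] at this
    rw [this, Complex.ofReal_re]
    rfl
  have hXX : (X * cfc Real.log X).trace =
      ((∑ i, ∑ j, overlap hX.1 hY.1 i j *
        (hX.1.eigenvalues i * Real.log (hX.1.eigenvalues i)) : ℝ) : ℂ) := by
    -- The weights must be the overlaps with the eigenbasis of `Y`, so `X log X` is treated as a
    -- single function of `X`.
    have h := trace_cfc hX.1 hY.1 (fun x => x * Real.log x)
    rw [← h]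
    congr 1
    rw [cfc_eq_diagonalized hX.1 (fun x => x * Real.log x), cfc_eq_diagonalized hX.1 Real.log]
    conv_lhs => enter [1]; rw [eq_diagonalized hX.1]
    set U := (hX.1.eigenvectorUnitary : Matrix n n ℂ)
    rw [show ∀ A B : Matrix n n ℂ, (U * A * Uᴴ) * (U * B * Uᴴ) = U * (A * (Uᴴ * U) * B) * Uᴴ by
      intro A B; simp only [Matrix.mul_assoc], eigenvectorUnitary_conjTranspose_mul_self,
      Matrix.mul_one, diagonal_mul_diagonal]
    simp
  have hXY : (X * cfc Real.log Y).trace =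
      ((∑ i, ∑ j, overlap hX.1 hY.1 i j *
        (hX.1.eigenvalues i * Real.log (hY.1.eigenvalues j)) : ℝ) : ℂ) := by
    have := trace_cfc_mul_cfc hX.1 hY.1 id Real.log
    rw [hXid] at this
    exact this
  rw [Matrix.mul_sub, trace_sub, hXX, hXY, Complex.sub_re, Complex.ofReal_re, Complex.ofReal_re,
    htr]
  have key : Tendsto (fun T : ℝ => ∑ i, ∑ j, overlap hX.1 hY.1 i j *
      (hX.1.eigenvalues i * (Real.log (hY.1.eigenvalues j + T * hX.1.eigenvalues i) -
        Real.log (hY.1.eigenvalues j)) - hX.1.eigenvalues i * Real.log T)) atTop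
      (𝓝 (∑ i, ∑ j, overlap hX.1 hY.1 i j *
        (hX.1.eigenvalues i * (Real.log (hX.1.eigenvalues i) -
          Real.log (hY.1.eigenvalues j))))) := by
    refine tendsto_finsetSum _ fun i _ => tendsto_finsetSum _ fun j _ => ?_
    rcases (hY.eigenvalues_nonneg j).eq_or_lt with h | h
    · have h0 := overlap_mul_eigenvalues_eq_zero hX.1 hY.1 hker i j h.symm
      simp only [← mul_sub, ← mul_assoc, h0, zero_mul]
      exact tendsto_const_nhds
    · exact (tendsto_mul_log_add_mul_sub (hX.eigenvalues_nonneg i) h).const_mul _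
  simp only [← Finset.sum_sub_distrib, ← mul_sub]
  refine key.congr' ?_
  filter_upwards [eventually_ge_atTop 0] with T hT
  rw [integral_resolventForm hX hY hker hT]
  simp only [mul_sub, Finset.sum_sub_distrib, Finset.sum_mul, mul_assoc]

end Spectral

/-! ### Traces of products of positive semidefinite matrices. -/

section Positivity

variable {n : Type*} [Fintype n] [DecidableEq n]

theorem exists_eq_conjTranspose_mul_self {A : Matrix n n ℂ} (hA : A.PosSemidef) :
    ∃ B : Matrix n n ℂ, A = Bᴴ * B := by
  open scoped MatrixOrder in
  exact CStarAlgebra.nonneg_iff_eq_star_mul_self.1 hA.nonneg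

theorem trace_mul_nonneg_of_posSemidef {A B : Matrix n n ℂ} (hA : A.PosSemidef) (hB : B.PosSemidef) :
    0 ≤ (A * B).trace := by
  obtain ⟨C, rfl⟩ := exists_eq_conjTranspose_mul_self hB
  rw [← Matrix.mul_assoc, trace_mul_comm, ← Matrix.mul_assoc]
  exact (hA.mul_mul_conjTranspose_same C).trace_nonneg

/-- With `A = Dᴴ D` and `B = Cᴴ C`, the trace is the squared Hilbert–Schmidt norm of `D Cᴴ`. -/
theorem mul_eq_zero_of_trace_mul_eq_zero {A B : Matrix n n ℂ} (hA : A.PosSemidef)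
    (hB : B.PosSemidef) (h : (A * B).trace = 0) : B * A = 0 := by
  obtain ⟨C, hC⟩ := exists_eq_conjTranspose_mul_self hB
  obtain ⟨D, hD⟩ := exists_eq_conjTranspose_mul_self hA
  have h1 : C * A * Cᴴ = 0 := by
    rw [← (hA.mul_mul_conjTranspose_same C).trace_eq_zero_iff, trace_mul_comm,
      ← Matrix.mul_assoc, ← hC, trace_mul_comm, h]
  have h2 : D * Cᴴ = 0 := by
    rw [← conjTranspose_mul_self_eq_zero, conjTranspose_mul, conjTranspose_conjTranspose, ← h1, hD]
    simp only [Matrix.mul_assoc]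
  have h3 : C * Dᴴ = 0 := by
    rw [← conjTranspose_conjTranspose C, ← conjTranspose_mul, h2, conjTranspose_zero]
  rw [hC, hD, show Cᴴ * C * (Dᴴ * D) = Cᴴ * (C * Dᴴ) * D by simp only [Matrix.mul_assoc], h3]
  simp

end Positivity

/-! ### Kadison–Schwarz and monotonicity under the adjoint map. -/

section Channel

variable {n m : Type*} [Fintype n] [Fintype m] [DecidableEq n] [DecidableEq m]
  {Φ : Matrix n n ℂ →ₗ[ℂ] Matrix m m ℂ}

theorem IsKPositive.posSemidef_fromBlocks (hΦ : IsKPositive 2 Φ) (hΦ1 : IsUnital Φ)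
    (W : Matrix n n ℂ) : (fromBlocks (Φ (W * Wᴴ)) (Φ W) (Φ Wᴴ) 1).PosSemidef := by
  -- `B` is the block column `(W, 1)`, so `B Bᴴ` has blocks `W Wᴴ`, `W`, `Wᴴ`, `1`.
  let B : Matrix (Fin 2 × n) n ℂ := of fun p j => if p.1 = 0 then W p.2 j else (1 : Matrix n n ℂ) p.2 j
  let A : Matrix (Fin 2) (Fin 2) (Matrix n n ℂ) := !![W * Wᴴ, W; Wᴴ, 1]
  have hA : Matrix.comp (Fin 2) (Fin 2) n n ℂ A = B * Bᴴ := by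
    ext ⟨a, i⟩ ⟨b, j⟩
    rw [comp_apply, Matrix.mul_apply]
    fin_cases a <;> fin_cases b <;>
      simp [A, B, Matrix.mul_apply, Matrix.one_apply]
  have h := (hΦ A (hA ▸ posSemidef_self_mul_conjTranspose B)).submatrix
    (Sum.elim (fun i => ((0 : Fin 2), i)) (fun i => ((1 : Fin 2), i)))
  have hone : Φ 1 = 1 := hΦ1
  convert h using 1
  ext (i | i) (j | j) <;> simp [A, comp_apply, hone]

theorem IsKPositive.map_conjTranspose (hΦ : IsKPositive 2 Φ) (hΦ1 : IsUnital Φ)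
    (W : Matrix n n ℂ) : Φ Wᴴ = (Φ W)ᴴ := by
  have h := (hΦ.posSemidef_fromBlocks hΦ1 W).1
  rw [IsHermitian, fromBlocks_conjTranspose, fromBlocks_inj] at h
  exact h.2.2.1.symm

/-- The Kadison–Schwarz inequality. -/
theorem IsKPositive.schwarz (hΦ : IsKPositive 2 Φ) (hΦ1 : IsUnital Φ)
    (W : Matrix n n ℂ) : (Φ (W * Wᴴ) - Φ W * (Φ W)ᴴ).PosSemidef := by
  have h := hΦ.posSemidef_fromBlocks hΦ1 W
  rw [hΦ.map_conjTranspose hΦ1] at h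
  let _ : Invertible (1 : Matrix m m ℂ) := invertibleOne
  -- Schur complement with respect to the identity block.
  have := (PosDef.fromBlocks₂₂ (Φ (W * Wᴴ)) (Φ W) (PosDef.one (n := m) (R := ℂ))).1 h
  simpa using this

theorem IsKPositive.map_posSemidef (hΦ : IsKPositive 2 Φ) (hΦ1 : IsUnital Φ)
    {A : Matrix n n ℂ} (hA : A.PosSemidef) : (Φ A).PosSemidef := by
  obtain ⟨B, rfl⟩ := exists_eq_conjTranspose_mul_self hA
  have h := (hΦ.schwarz hΦ1 Bᴴ).add (posSemidef_self_mul_conjTranspose (Φ Bᴴ))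
  simpa using h

theorem trace_mul_hsAdjoint_of_isKPositive (hΦ : IsKPositive 2 Φ) (hΦ1 : IsUnital Φ)
    (A : Matrix n n ℂ) (X : Matrix m m ℂ) :
    (A * hsAdjoint Φ X).trace = (Φ A * X).trace := by
  have h := trace_mul_hsAdjoint Φ Aᴴ X
  rwa [hΦ.map_conjTranspose hΦ1, conjTranspose_conjTranspose, conjTranspose_conjTranspose] at h

theorem star_dotProduct_mulVec_eq_trace {n : Type*} [Fintype n] (A : Matrix n n ℂ) (v : n → ℂ) :
    star v ⬝ᵥ (A *ᵥ v) = (vecMulVec v (star v) * A).trace := by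
  rw [vecMulVec_mul, trace_vecMulVec, dotProduct_mulVec, dotProduct_comm]

theorem IsKPositive.hsAdjoint_posSemidef (hΦ : IsKPositive 2 Φ) (hΦ1 : IsUnital Φ)
    {X : Matrix m m ℂ} (hX : X.PosSemidef) : (hsAdjoint Φ X).PosSemidef := by
  refine PosSemidef.of_dotProduct_mulVec_nonneg ?_ fun v => ?_
  · ext i j
    have h : (single i j (1 : ℂ))ᴴ = single j i 1 := by simp
    rw [conjTranspose_apply]
    simp only [hsAdjoint, LinearMap.coe_mk, AddHom.coe_mk, of_apply]
    rw [← trace_conjTranspose, conjTranspose_mul, conjTranspose_conjTranspose, hX.1.eq,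
      ← hΦ.map_conjTranspose hΦ1, h, trace_mul_comm]
  · rw [star_dotProduct_mulVec_eq_trace, trace_mul_hsAdjoint_of_isKPositive hΦ hΦ1]
    exact trace_mul_nonneg_of_posSemidef (hΦ.map_posSemidef hΦ1 (posSemidef_vecMulVec_self_star v)) hX

theorem IsKPositive.trace_hsAdjoint (hΦ : IsKPositive 2 Φ) (hΦ1 : IsUnital Φ)
    (X : Matrix m m ℂ) : (hsAdjoint Φ X).trace = X.trace := by
  have h := trace_mul_hsAdjoint_of_isKPositive hΦ hΦ1 1 X
  rwa [show Φ 1 = 1 from hΦ1, Matrix.one_mul, Matrix.one_mul] at h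

/-- With `P = Φ (v vᴴ) ≥ 0`, the hypothesis on `v` gives `tr (P Y) = 0`, hence `Y P = 0`. The
columns of `P` then lie in `ker Y ⊆ ker X`, so `tr (P X) = 0`, which is `⟨v, Φ† X v⟩ = 0`. -/
theorem IsKPositive.ker_hsAdjoint (hΦ : IsKPositive 2 Φ) (hΦ1 : IsUnital Φ)
    {X Y : Matrix m m ℂ} (hX : X.PosSemidef) (hY : Y.PosSemidef)
    (hker : ∀ v : m → ℂ, Y *ᵥ v = 0 → X *ᵥ v = 0) (v : n → ℂ)
    (hv : hsAdjoint Φ Y *ᵥ v = 0) : hsAdjoint Φ X *ᵥ v = 0 := by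
  have hP := hΦ.map_posSemidef hΦ1 (posSemidef_vecMulVec_self_star v)
  have h1 : (Φ (vecMulVec v (star v)) * Y).trace = 0 := by
    rw [← trace_mul_hsAdjoint_of_isKPositive hΦ hΦ1, ← star_dotProduct_mulVec_eq_trace, hv,
      dotProduct_zero]
  have h2 := mul_eq_zero_of_trace_mul_eq_zero hP hY h1
  have h3 : X * Φ (vecMulVec v (star v)) = 0 := by
    refine Matrix.ext_of_mulVec_single fun i => ?_
    rw [← mulVec_mulVec, zero_mulVec]
    apply hker
    rw [mulVec_mulVec, h2, zero_mulVec]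
  rw [← (hΦ.hsAdjoint_posSemidef hΦ1 hX).dotProduct_mulVec_zero_iff,
    star_dotProduct_mulVec_eq_trace, trace_mul_hsAdjoint_of_isKPositive hΦ hΦ1, trace_mul_comm, h3,
    trace_zero]

theorem IsKPositive.varForm_hsAdjoint_le (hΦ : IsKPositive 2 Φ) (hΦ1 : IsUnital Φ)
    {X Y : Matrix m m ℂ} (hX : X.PosSemidef) (hY : Y.PosSemidef) {t : ℝ} (ht : 0 ≤ t)
    (W : Matrix n n ℂ) :
    varForm t (hsAdjoint Φ X) (hsAdjoint Φ Y) W ≤ varForm t X Y (Φ W) := by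
  -- The inequality for `W` is paired with `Y` (left multiplication), that for `Wᴴ` with `X` (right
  -- multiplication).
  have hs := hΦ.schwarz hΦ1 W
  have hs' := hΦ.schwarz hΦ1 Wᴴ
  rw [conjTranspose_conjTranspose, hΦ.map_conjTranspose hΦ1, conjTranspose_conjTranspose] at hs'
  have h1 := (Complex.le_def.1 (trace_mul_nonneg_of_posSemidef hs hY)).1
  have h2 := (Complex.le_def.1 (trace_mul_nonneg_of_posSemidef hs' hX)).1
  rw [Matrix.sub_mul, trace_sub, Complex.sub_re, Complex.zero_re] at h1 h2
  rw [varForm, varForm, trace_mul_comm (hsAdjoint Φ Y)]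
  simp only [trace_mul_hsAdjoint_of_isKPositive hΦ hΦ1]
  rw [hΦ.map_conjTranspose hΦ1, trace_mul_comm Y]
  have := mul_nonneg ht h2
  linarith

theorem IsKPositive.resolventForm_hsAdjoint_le (hΦ : IsKPositive 2 Φ) (hΦ1 : IsUnital Φ)
    {X Y : Matrix m m ℂ} (hX : X.PosSemidef) (hY : Y.PosSemidef) {t : ℝ} (ht : 0 < t) :
    resolventForm (hΦ.hsAdjoint_posSemidef hΦ1 hX).1 (hΦ.hsAdjoint_posSemidef hΦ1 hY).1 t ≤
      resolventForm hX.1 hY.1 t := by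
  -- `W` is a maximizer for the images; `Φ W` is then a competitor for `X` and `Y`.
  obtain ⟨W, hW⟩ := exists_varForm_eq_resolventForm (hΦ.hsAdjoint_posSemidef hΦ1 hX)
    (hΦ.hsAdjoint_posSemidef hΦ1 hY) ht
  rw [← hW]
  exact (hΦ.varForm_hsAdjoint_le hΦ1 hX hY ht.le W).trans (varForm_le_resolventForm hX hY ht _)

/-- The data processing inequality holds for all unital `2`-positive maps. -/
theorem IsKPositive.relEntropy_hsAdjoint_le (hΦ : IsKPositive 2 Φ) (hΦ1 : IsUnital Φ)
    {X Y : Matrix m m ℂ} (hX : X.PosSemidef) (hY : Y.PosSemidef) :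
    relEntropy (hsAdjoint Φ X) (hsAdjoint Φ Y) ≤ relEntropy X Y := by
  by_cases hker : ∀ v : m → ℂ, Y *ᵥ v = 0 → X *ᵥ v = 0
  swap
  · rw [relEntropy, relEntropy, if_neg hker]
    exact le_top
  have hker' := hΦ.ker_hsAdjoint hΦ1 hX hY hker
  have hX' := hΦ.hsAdjoint_posSemidef hΦ1 hX
  have hY' := hΦ.hsAdjoint_posSemidef hΦ1 hY
  rw [relEntropy, relEntropy, if_pos hker, if_pos hker', EReal.coe_le_coe_iff]
  refine le_of_tendsto_of_tendsto (tendsto_integral_resolventForm hX' hY' hker')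
    (tendsto_integral_resolventForm hX hY hker) ?_
  filter_upwards [eventually_ge_atTop 0] with T hT
  rw [hΦ.trace_hsAdjoint hΦ1]
  refine sub_le_sub_right ?_ _
  -- The open interval suffices and excludes `t = 0`, where the comparison of resolvent forms is not
  -- available.
  refine intervalIntegral.integral_mono_on_of_le_Ioo hT
    (intervalIntegrable_resolventForm hX' hY' hker' hT)
    (intervalIntegrable_resolventForm hX hY hker hT) fun t ht => ?_
  exact hΦ.resolventForm_hsAdjoint_le hΦ1 hX hY ht.1

end Channel

end QuantumDPI

theorem theorem2p8 (m n : ℕ) (X Y : Matrix (Fin m) (Fin m) ℂ)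
    (hX : X.PosSemidef) (hY : Y.PosSemidef)
    (Φ : Matrix (Fin n) (Fin n) ℂ →ₗ[ℂ] Matrix (Fin m) (Fin m) ℂ)
    (hΦ : QuantumDPI.IsCompletelyPositive Φ) (hΦ1 : QuantumDPI.IsUnital Φ) :
    QuantumDPI.relEntropy (QuantumDPI.hsAdjoint Φ X) (QuantumDPI.hsAdjoint Φ Y) ≤
      QuantumDPI.relEntropy X Y :=
  (hΦ 2).relEntropy_hsAdjoint_le hΦ1 hX hY
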